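/- Let $D>1$ be an integer and let $S_k$ denote the surface area of the $k$-dimensional unit sphere (so $S_0=2$, $S_1=2\pi$). For a Borel probability measure $\upsilon$ on $\mathbb{R}^D$, $\theta\in\mathbb{S}^{D-1}$ and $t\in\mathbb{R}$ put $\mathrm{SCDF}_\upsilon(\theta,t)=\upsilon(\{x:\langle x,\theta\rangle\le t\})$, and define the sliced continuous ranking probability score $$\mathrm{SCRPS}(\gamma,\omega)=\frac1{S_{D-1}}\int_{\mathbb{S}^{D-1}}\Big[\int_{-\infty}^{\infty}|\mathrm{SCDF}_\gamma(\theta,t)-\mathrm{SCDF}_\omega(\theta,t)|^2\,dt\Big]d\theta$$ and the energy distance $$\mathcal{E}(\gamma,\omega)=2\,\mathbb{E}\|X-Y\|-\mathbb{E}\|X-X'\|-\mathbb{E}\|Y-Y'\|,$$ with $X,X'\sim\gamma$ and $Y,Y'\sim\omega$ independent and $\|\cdot\|$ the Euclidean norm. Put $C_D=(D-1)\frac{S_{D-1}}{S_{D-2}}$. (1) If $\gamma,\omega$ are Borel probability measures on $\mathbb{R}^D$ with finite first moments, then all the integrals above converge absolutely and $\mathcal{E}(\gamma,\omega)=C_D\cdot\mathrm{SCRPS}(\gamma,\omega)$.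 (2) Let $R>0$, let $\mathcal{X}\subset\mathbb{R}^D$ be a compact subset of the closed ball of radius $R$ centred at $0$, and let $\mathcal{P}(\mathcal{X})$ be the set of Borel probability measures on $\mathcal{X}$. A loss $\lambda:\mathcal{P}(\mathcal{X})\times\mathcal{P}(\mathcal{X})\to\mathbb{R}$ is called $\eta$-mixable if for all $N\ge1$, all probability vectors $(w^1,\dots,w^N)$ and all $\gamma^1,\dots,\gamma^N\in\mathcal{P}(\mathcal{X})$ there is $\overline\gamma\in\mathcal{P}(\mathcal{X})$ such that $\exp[-\eta\lambda(\overline\gamma,\omega)]\ge\sum_{n}w^n\exp[-\eta\lambda(\gamma^n,\omega)]$ for all $\omega\in\mathcal{P}(\mathcal{X})$; it is called $\eta$-exp-concave if this always holds with the mixture $\overline\gamma=\sum_n w^n\gamma^n$. Then for every $\eta>0$ the loss $\mathcal{E}$ is $\frac{\eta}{C_D}$-mixable (respectively $\frac{\eta}{C_D}$-exp-concave) if and only if $\mathrm{SCRPS}$ is $\eta$-mixable (respectively $\eta$-exp-concave). Moreover, $\mathrm{SCRPS}$ is $\eta$-mixable for all $0<\eta\le\frac1R$ and $\eta$-exp-concave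 for all $0<\eta\le\frac1{4R}$; hence $\mathcal{E}$ is $\eta$-mixable for all $0<\eta\le\frac{1}{R\,C_D}$ and $\eta$-exp-concave for all $0<\eta\le\frac{1}{4R\,C_D}$. -/

import Mathlib

open MeasureTheory Metric
open scoped NNReal

noncomputable section

/-- A loss `loss : Γ × Ω → ℝ` is `η`-mixable: for every `N`, all probability weights `w` and all
forecasts `γ 1, …, γ N ∈ Γ` there is one aggregated forecast in `Γ` that works for all
outcomes `ω ∈ Ω`. (`N = 0` is excluded by `∑ n, w n = 1`.) -/
def IsMixable {A B : Type*} (Γ : Set A) (Ω : Set B) (loss : A → B → ℝ) (η : ℝ) : Prop :=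
  ∀ (N : ℕ) (w : Fin N → ℝ≥0), ∑ n, w n = 1 →
    ∀ γ : Fin N → A, (∀ n, γ n ∈ Γ) →
      ∃ γbar ∈ Γ, ∀ ω ∈ Ω,
        ∑ n, (w n : ℝ) * Real.exp (-η * loss (γ n) ω) ≤ Real.exp (-η * loss γbar ω)

/-- A loss `loss : Γ × Ω → ℝ` on a convex set `Γ` is `η`-exponentially concave: the convex
combination of the forecasts can be used as the aggregated forecast. Only convex combinations
matter, so nonnegative scalars suffice; they act on real vector spaces and also on measures,
where `∑ n, w n • γ n` is the mixture. -/
def IsExpConcave {A B : Type*} [AddCommMonoid A] [Module ℝ≥0 A]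
    (Γ : Set A) (Ω : Set B) (loss : A → B → ℝ) (η : ℝ) : Prop :=
  Convex ℝ≥0 Γ ∧
  ∀ (N : ℕ) (w : Fin N → ℝ≥0), ∑ n, w n = 1 →
    ∀ γ : Fin N → A, (∀ n, γ n ∈ Γ) → ∀ ω ∈ Ω,
      ∑ n, (w n : ℝ) * Real.exp (-η * loss (γ n) ω) ≤
        Real.exp (-η * loss (∑ n, w n • γ n) ω)

/-- The surface area of the unit sphere of `ℝ^d`, a sphere of dimension `d - 1`. -/
def unitSphereArea (d : ℕ) : ℝ :=
  (volume : Measure (EuclideanSpace ℝ (Fin d))).toSphere.real Set.univ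

/-- The sliced cumulative distribution function `υ {x | ⟨x, θ⟩ ≤ t}`. -/
def scdf {D : ℕ} (υ : Measure (EuclideanSpace ℝ (Fin D)))
    (θ : sphere (0 : EuclideanSpace ℝ (Fin D)) 1) (t : ℝ) : ℝ :=
  υ.real {x | inner ℝ x (θ : EuclideanSpace ℝ (Fin D)) ≤ t}

/-- The sliced continuous ranking probability score; the outer integral is with respect to
the surface measure of the unit sphere of `ℝ^D`. -/
def scrps {D : ℕ} (γ ω : Measure (EuclideanSpace ℝ (Fin D))) : ℝ :=
  1 / unitSphereArea D *
    ∫ θ, (∫ t : ℝ, |scdf γ θ t - scdf ω θ t| ^ 2)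
      ∂(volume : Measure (EuclideanSpace ℝ (Fin D))).toSphere

/-- The energy distance `2 E‖X - Y‖ - E‖X - X'‖ - E‖Y - Y'‖`. -/
def energyDist {D : ℕ} (γ ω : Measure (EuclideanSpace ℝ (Fin D))) : ℝ :=
  2 * (∫ p, ‖p.1 - p.2‖ ∂(γ.prod ω))
    - (∫ p, ‖p.1 - p.2‖ ∂(γ.prod γ)) - (∫ p, ‖p.1 - p.2‖ ∂(ω.prod ω))

/-- The constant `(D - 1) S_{D-1} / S_{D-2}`, where `S_k` is the area of the unit sphere of
dimension `k`, that is, of the unit sphere of `ℝ^(k+1)`. -/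
def energyConst (D : ℕ) : ℝ :=
  ((D : ℝ) - 1) * (unitSphereArea D / unitSphereArea (D - 1))

/-- The Borel probability measures on `X ⊆ ℝ^D`, seen as measures on `ℝ^D` carried by `X`. -/
def probOn {D : ℕ} (X : Set (EuclideanSpace ℝ (Fin D))) :
    Set (Measure (EuclideanSpace ℝ (Fin D))) :=
  {υ | IsProbabilityMeasure υ ∧ υ Xᶜ = 0}

end

/-!
The identity between the energy distance and the sliced score rests on the volume of the set of
all `((θ, t), (x, y))` with `⟨x, θ⟩ ≤ t < ⟨y, θ⟩`. Slicing it in the two possible orders gives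
`∫∫ F (1 - G) dt dθ = κ 𝔼‖X - Y‖`, where `F`, `G` are the sliced distribution functions of the
laws of `X`, `Y` and `κ ‖v‖` is the integral of the positive part of `⟨v, θ⟩` over the sphere
(`lintegral_scdf_mul_one_sub_scdf`). The value of `κ`, the volume of the unit ball one dimension
lower, comes from a Gaussian integral in polar coordinates (`integral_max_inner_toSphere`). Since
`(F - G)² = F (1 - G) + G (1 - F) - F (1 - F) - G (1 - G)`, four instances of this formula give
the identity.

For measures carried by the ball of radius `R` the thresholds `t` outside `[-R, R]` do not
contribute, so the sliced score is `2 R` times the mean of `(F - G)²` over a probability space of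
pairs `(θ, t)`. Bounds between exponentials survive averaging (`sum_exp_integral_le`), so
the rates of the square loss on `[0, 1]`, which is mixable at rate `2` and exponentially concave
at rate `1 / 2`, pass to the sliced score at rates `1 / R` and `1 / (4 R)`.
Exponential concavity follows at once, because the sliced distribution function is affine in the
measure. For mixability, the pointwise aggregate of sliced distribution functions need not be the
sliced distribution function of a measure on `X`. It is therefore projected in `L²` onto the set
of those that are, which is convex, and compact by Prokhorov's theorem and the
identity above (`continuousOn_toLp_scdf`). The projection onto a convex set does not
increase the distance to any point of the set, hence not the loss for any outcome
(`exists_mem_probOn_forall_integral_le`).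
-/

/-! ### Aggregation of real-valued forecasts under the square loss -/

/-- Hoeffding's lemma for a centred Bernoulli variable of mean `b`, in the form that gives
mixability of the square loss at every rate `a ≤ 2`. -/
theorem bernoulli_exp_le_one {a b x : ℝ} (ha : 0 ≤ a) (ha2 : a ≤ 2) (hb0 : 0 ≤ b) (hb1 : b ≤ 1) :
    (1 - b) * Real.exp (-a * (x ^ 2 - b ^ 2)) +
      b * Real.exp (-a * ((x - 1) ^ 2 - (b - 1) ^ 2)) ≤ 1 := by
  -- the Bernoulli law of mean `b`
  let μ : Measure ℝ := ENNReal.ofReal (1 - b) • Measure.dirac 0 + ENNReal.ofReal b • Measure.dirac 1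
  have : IsProbabilityMeasure μ := ⟨by
    simp only [μ, Measure.coe_add, Measure.coe_smul, Pi.add_apply, Pi.smul_apply, measure_univ,
      smul_eq_mul, mul_one]
    rw [← ENNReal.ofReal_add (by linarith) hb0]; simp⟩
  have key : ∀ f : ℝ → ℝ, ∫ t, f t ∂μ = (1 - b) * f 0 + b * f 1 := by
    intro f
    rw [integral_add_measure, integral_smul_measure, integral_smul_measure, integral_dirac,
      integral_dirac, ENNReal.toReal_ofReal (by linarith), ENNReal.toReal_ofReal hb0]
    · rfl
    · exact (integrable_dirac (by simp)).smul_measure (by simp)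
    · exact (integrable_dirac (by simp)).smul_measure (by simp)
  have hoeff := ProbabilityTheory.hasSubgaussianMGF_of_mem_Icc (μ := μ) (X := fun t => t)
    (a := 0) (b := 1) aemeasurable_id (by
      simp only [μ, ae_add_measure_iff]
      constructor <;> refine Measure.ae_smul_measure ?_ _ <;> simp [ae_dirac_eq])
  have h := hoeff.mgf_le (2 * a * (x - b))
  rw [ProbabilityTheory.mgf, key] at h
  simp only [key] at h
  have hle : Real.exp ((((‖(1:ℝ) - 0‖₊ / 2) ^ 2 : ℝ≥0) : ℝ) * (2 * a * (x - b)) ^ 2 / 2)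
      ≤ Real.exp (a * (x - b) ^ 2) := by
    apply Real.exp_le_exp.2
    simp
    nlinarith [mul_nonneg (mul_nonneg ha (sub_nonneg.2 ha2)) (sq_nonneg (x - b))]
  have h2 := h.trans hle
  have e1 : Real.exp (-a * (x ^ 2 - b ^ 2)) = Real.exp (-(a * (x - b) ^ 2)) *
      Real.exp (2 * a * (x - b) * (0 - ((1 - b) * 0 + b * 1))) := by
    rw [← Real.exp_add]; congr 1; ring
  have e2 : Real.exp (-a * ((x - 1) ^ 2 - (b - 1) ^ 2)) = Real.exp (-(a * (x - b) ^ 2)) *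
      Real.exp (2 * a * (x - b) * (1 - ((1 - b) * 0 + b * 1))) := by
    rw [← Real.exp_add]; congr 1; ring
  rw [e1, e2]
  calc _ = Real.exp (-(a * (x - b) ^ 2)) *
        ((1 - b) * Real.exp (2 * a * (x - b) * (0 - ((1 - b) * 0 + b * 1))) +
          b * Real.exp (2 * a * (x - b) * (1 - ((1 - b) * 0 + b * 1)))) := by ring
    _ ≤ Real.exp (-(a * (x - b) ^ 2)) * Real.exp (a * (x - b) ^ 2) := by gcongr
    _ = 1 := by rw [← Real.exp_add]; simp

/-- The aggregated forecast of the square loss at rate `a`. It equalizes the excess loss at the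
outcomes `0` and `1`. -/
noncomputable def squareLossAggregate {N : ℕ} (a : ℝ) (w : Fin N → ℝ≥0) (x : Fin N → ℝ) : ℝ :=
  1 / 2 + (Real.log (∑ n, (w n : ℝ) * Real.exp (-a * (x n - 1) ^ 2)) -
    Real.log (∑ n, (w n : ℝ) * Real.exp (-a * (x n) ^ 2))) / (2 * a)

section squareLoss

variable {N : ℕ} {a : ℝ} {w : Fin N → ℝ≥0} {x : Fin N → ℝ}

theorem sum_weight_coe (hw : ∑ n, w n = 1) : ∑ n, (w n : ℝ) = 1 := by
  exact_mod_cast congrArg ((↑) : ℝ≥0 → ℝ) hw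

theorem sum_weight_mul_exp_pos (hw : ∑ n, w n = 1) (f : Fin N → ℝ) :
    0 < ∑ n, (w n : ℝ) * Real.exp (f n) := by
  by_contra! h
  have h0 := (Finset.sum_eq_zero_iff_of_nonneg (s := Finset.univ)
    (f := fun n => (w n : ℝ) * Real.exp (f n)) (fun n _ => by positivity)).1
    (le_antisymm h (Finset.sum_nonneg fun n _ => by positivity))
  have : ∑ n, (w n : ℝ) = 0 := Finset.sum_eq_zero fun n hn => by
    simpa [(Real.exp_pos _).ne'] using h0 n hn
  rw [sum_weight_coe hw] at this
  exact one_ne_zero this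

theorem squareLossAggregate_mem_Icc (ha : 0 < a) (hw : ∑ n, w n = 1)
    (hx : ∀ n, x n ∈ Set.Icc (0 : ℝ) 1) : squareLossAggregate a w x ∈ Set.Icc (0 : ℝ) 1 := by
  have p0 := sum_weight_mul_exp_pos hw fun n => -a * (x n) ^ 2
  have p1 := sum_weight_mul_exp_pos hw fun n => -a * (x n - 1) ^ 2
  have h1 : ∑ n, (w n : ℝ) * Real.exp (-a * (x n - 1) ^ 2) ≤
      Real.exp a * ∑ n, (w n : ℝ) * Real.exp (-a * (x n) ^ 2) := by
    rw [Finset.mul_sum]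
    refine Finset.sum_le_sum fun n _ => ?_
    rw [mul_left_comm, ← Real.exp_add]
    gcongr
    nlinarith [mul_nonneg ha.le (sub_nonneg.2 (hx n).2)]
  have h0 : ∑ n, (w n : ℝ) * Real.exp (-a * (x n) ^ 2) ≤
      Real.exp a * ∑ n, (w n : ℝ) * Real.exp (-a * (x n - 1) ^ 2) := by
    rw [Finset.mul_sum]
    refine Finset.sum_le_sum fun n _ => ?_
    rw [mul_left_comm, ← Real.exp_add]
    gcongr
    nlinarith [mul_nonneg ha.le (hx n).1]
  have l1 := Real.log_le_log p1 h1
  have l0 := Real.log_le_log p0 h0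
  rw [Real.log_mul (Real.exp_pos _).ne' p0.ne', Real.log_exp] at l1
  rw [Real.log_mul (Real.exp_pos _).ne' p1.ne', Real.log_exp] at l0
  unfold squareLossAggregate
  constructor
  · have : -(1 / 2) ≤ (Real.log (∑ n, (w n : ℝ) * Real.exp (-a * (x n - 1) ^ 2)) -
      Real.log (∑ n, (w n : ℝ) * Real.exp (-a * (x n) ^ 2))) / (2 * a) := by
      rw [le_div_iff₀ (by positivity)]; linarith
    linarith
  · have : (Real.log (∑ n, (w n : ℝ) * Real.exp (-a * (x n - 1) ^ 2)) -
      Real.log (∑ n, (w n : ℝ) * Real.exp (-a * (x n) ^ 2))) / (2 * a) ≤ 1 / 2 := by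
      rw [div_le_iff₀ (by positivity)]; linarith
    linarith

/-- Mixability of the square loss on `[0, 1]` at every rate `a ≤ 2`, for all outcomes
in `[0, 1]` and not only for binary ones. -/
theorem sum_exp_le_exp_squareLossAggregate (ha : 0 < a) (ha2 : a ≤ 2) (hw : ∑ n, w n = 1)
    (hx : ∀ n, x n ∈ Set.Icc (0 : ℝ) 1) {y : ℝ} (hy : y ∈ Set.Icc (0 : ℝ) 1) :
    ∑ n, (w n : ℝ) * Real.exp (-a * (x n - y) ^ 2) ≤
      Real.exp (-a * (squareLossAggregate a w x - y) ^ 2) := by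
  obtain ⟨hb0, hb1⟩ := squareLossAggregate_mem_Icc ha hw hx
  set b := squareLossAggregate a w x with hb
  set A : ℝ := ∑ n, (w n : ℝ) * Real.exp (-a * ((x n) ^ 2 - b ^ 2)) with hA
  set A' : ℝ := ∑ n, (w n : ℝ) * Real.exp (-a * ((x n - 1) ^ 2 - (b - 1) ^ 2)) with hA'
  have p0 := sum_weight_mul_exp_pos hw fun n => -a * (x n) ^ 2
  have p1 := sum_weight_mul_exp_pos hw fun n => -a * (x n - 1) ^ 2
  have eA : A = Real.exp (a * b ^ 2) * ∑ n, (w n : ℝ) * Real.exp (-a * (x n) ^ 2) := by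
    rw [hA, Finset.mul_sum]
    refine Finset.sum_congr rfl fun n _ => ?_
    rw [mul_left_comm, ← Real.exp_add]; congr 2; ring
  have eA' : A' = Real.exp (a * (b - 1) ^ 2) *
      ∑ n, (w n : ℝ) * Real.exp (-a * (x n - 1) ^ 2) := by
    rw [hA', Finset.mul_sum]
    refine Finset.sum_congr rfl fun n _ => ?_
    rw [mul_left_comm, ← Real.exp_add]; congr 2; ring
  have hAA : A = A' := by
    rw [eA, eA']
    conv_lhs => rw [← Real.exp_log p0]
    conv_rhs => rw [← Real.exp_log p1]
    rw [← Real.exp_add, ← Real.exp_add]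
    congr 1
    have : 2 * a * b = a + (Real.log (∑ n, (w n : ℝ) * Real.exp (-a * (x n - 1) ^ 2)) -
        Real.log (∑ n, (w n : ℝ) * Real.exp (-a * (x n) ^ 2))) := by
      rw [hb, squareLossAggregate]; field_simp
    linear_combination this
  have hA1 : A ≤ 1 := by
    have : (1 - b) * A + b * A' ≤ 1 := by
      rw [hA, hA', Finset.mul_sum, Finset.mul_sum, ← Finset.sum_add_distrib]
      refine (Finset.sum_le_sum fun n _ => ?_).trans_eq (sum_weight_coe hw)
      have := mul_le_mul_of_nonneg_left (bernoulli_exp_le_one (x := x n) ha.le ha2 hb0 hb1)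
        (w n).coe_nonneg
      linarith
    rw [← hAA] at this
    linarith
  -- the excess loss is affine in the outcome, so its exponential lies below the chord
  have hT : ∑ n, (w n : ℝ) * Real.exp (-a * ((x n - y) ^ 2 - (b - y) ^ 2)) ≤
      (1 - y) * A + y * A' := by
    rw [hA, hA', Finset.mul_sum, Finset.mul_sum, ← Finset.sum_add_distrib]
    refine Finset.sum_le_sum fun n _ => ?_
    have hc := convexOn_exp.2 (Set.mem_univ (-a * ((x n) ^ 2 - b ^ 2)))
      (Set.mem_univ (-a * ((x n - 1) ^ 2 - (b - 1) ^ 2))) (sub_nonneg.2 hy.2) hy.1 (by ring)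
    simp only [smul_eq_mul] at hc
    have e : (1 - y) * (-a * ((x n) ^ 2 - b ^ 2)) + y * (-a * ((x n - 1) ^ 2 - (b - 1) ^ 2)) =
        -a * ((x n - y) ^ 2 - (b - y) ^ 2) := by ring
    rw [e] at hc
    have := mul_le_mul_of_nonneg_left hc (w n).coe_nonneg
    linarith
  calc ∑ n, (w n : ℝ) * Real.exp (-a * (x n - y) ^ 2)
      = Real.exp (-a * (b - y) ^ 2) *
        ∑ n, (w n : ℝ) * Real.exp (-a * ((x n - y) ^ 2 - (b - y) ^ 2)) := by
        rw [Finset.mul_sum]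
        refine Finset.sum_congr rfl fun n _ => ?_
        rw [mul_left_comm, ← Real.exp_add]; congr 2; ring
    _ ≤ Real.exp (-a * (b - y) ^ 2) * 1 := by
        gcongr
        rw [← hAA] at hT
        linarith
    _ = _ := mul_one _

theorem concaveOn_exp_neg_mul_sq (ha : 0 ≤ a) (ha2 : a ≤ 1 / 2) :
    ConcaveOn ℝ (Set.Icc (-1) 1) fun t : ℝ => Real.exp (-a * t ^ 2) := by
  have hd : ∀ t : ℝ, HasDerivAt (fun t : ℝ => Real.exp (-a * t ^ 2))
      (Real.exp (-a * t ^ 2) * (-a * (2 * t))) t := fun t => by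
    have := ((hasDerivAt_pow 2 t).const_mul (-a)).exp
    simpa using this
  have hd2 : ∀ t : ℝ, HasDerivAt (fun t : ℝ => Real.exp (-a * t ^ 2) * (-a * (2 * t)))
      (Real.exp (-a * t ^ 2) * (-a * (2 * t)) * (-a * (2 * t)) +
        Real.exp (-a * t ^ 2) * (-a * 2)) t := fun t => by
    have h := ((hasDerivAt_id t).const_mul 2).const_mul (-a)
    simp only [id, mul_one] at h
    exact (hd t).mul h
  refine concaveOn_of_hasDerivWithinAt2_nonpos (convex_Icc _ _) (by fun_prop)
    (fun t _ => (hd t).hasDerivWithinAt) (fun t _ => (hd2 t).hasDerivWithinAt) fun t ht => ?_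
  rw [interior_Icc] at ht
  have ht2 : t ^ 2 ≤ 1 := by nlinarith [ht.1, ht.2]
  have : Real.exp (-a * t ^ 2) * (-a * (2 * t)) * (-a * (2 * t)) +
      Real.exp (-a * t ^ 2) * (-a * 2) = Real.exp (-a * t ^ 2) * (2 * a * (2 * a * t ^ 2 - 1)) := by
    ring
  rw [this]
  refine mul_nonpos_of_nonneg_of_nonpos (Real.exp_pos _).le
    (mul_nonpos_of_nonneg_of_nonpos (by linarith) ?_)
  nlinarith

/-- Exponential concavity of the square loss on `[0, 1]` at every rate `a ≤ 1 / 2`. -/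
theorem sum_exp_le_exp_sum (ha : 0 ≤ a) (ha2 : a ≤ 1 / 2) (hw : ∑ n, w n = 1)
    (hx : ∀ n, x n ∈ Set.Icc (0 : ℝ) 1) {y : ℝ} (hy : y ∈ Set.Icc (0 : ℝ) 1) :
    ∑ n, (w n : ℝ) * Real.exp (-a * (x n - y) ^ 2) ≤
      Real.exp (-a * (∑ n, (w n : ℝ) * x n - y) ^ 2) := by
  have h := (concaveOn_exp_neg_mul_sq ha ha2).le_map_sum (t := Finset.univ)
    (w := fun n => (w n : ℝ)) (p := fun n => x n - y) (fun n _ => (w n).coe_nonneg)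
    (sum_weight_coe hw) (fun n _ => ⟨by linarith [(hx n).1, hy.2], by linarith [(hx n).2, hy.1]⟩)
  have e : ∑ n, (w n : ℝ) * (x n - y) = ∑ n, (w n : ℝ) * x n - y := by
    simp only [mul_sub, Finset.sum_sub_distrib, ← Finset.sum_mul, sum_weight_coe hw, one_mul]
  simpa only [smul_eq_mul, e] using h

end squareLoss

/-! ### Integrated losses -/

/-- Averaging over a probability measure preserves a pointwise bound between exponentials of
losses: the function `u ↦ log ∑ n, w n * exp (u n)` is convex, and the proof is Jensen's
inequality for its tangent plane at the vector of means. -/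
theorem sum_exp_integral_le {Ω : Type*} [MeasurableSpace Ω] {P : Measure Ω}
    [IsProbabilityMeasure P] {N : ℕ} (w : Fin N → ℝ≥0) {f : Fin N → Ω → ℝ} {g : Ω → ℝ}
    (hf : ∀ n, Integrable (f n) P) (hg : Integrable g P)
    (h : ∀ q, ∑ n, (w n : ℝ) * Real.exp (f n q) ≤ Real.exp (g q)) :
    ∑ n, (w n : ℝ) * Real.exp (∫ q, f n q ∂P) ≤ Real.exp (∫ q, g q ∂P) := by
  set m : Fin N → ℝ := fun n => ∫ q, f n q ∂P with hm
  set Z : ℝ := ∑ n, (w n : ℝ) * Real.exp (m n) with hZ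
  rcases (Finset.sum_nonneg fun n _ => by positivity : 0 ≤ Z).eq_or_lt with h0 | hpos
  · rw [hZ, ← h0]; positivity
  have hpt : ∀ q, Real.log Z + ∑ n, (w n * Real.exp (m n) / Z) * (f n q - m n) ≤ g q := by
    intro q
    rw [← Real.exp_le_exp]
    refine le_trans ?_ (h q)
    rw [Real.exp_add, Real.exp_log hpos]
    have hj := convexOn_exp.map_sum_le (t := Finset.univ)
      (w := fun n => (w n : ℝ) * Real.exp (m n) / Z) (p := fun n => f n q - m n)
      (fun n _ => by positivity) (by rw [← Finset.sum_div, ← hZ, div_self hpos.ne'])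
      (fun _ _ => Set.mem_univ _)
    simp only [smul_eq_mul] at hj
    calc _ ≤ Z * ∑ n, (w n : ℝ) * Real.exp (m n) / Z * Real.exp (f n q - m n) := by gcongr
      _ = _ := by
        rw [Finset.mul_sum]
        refine Finset.sum_congr rfl fun n _ => ?_
        rw [Real.exp_sub]
        have := hpos.ne'
        rw [← hZ] at this
        field_simp
  have hint : ∀ n, Integrable (fun q => (w n * Real.exp (m n) / Z) * (f n q - m n)) P :=
    fun n => ((hf n).sub (integrable_const _)).const_mul _
  have hi := integral_mono ((integrable_const _).add
    (integrable_finsetSum _ fun n _ => hint n)) hg hpt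
  have e : ∫ q, (Real.log Z + ∑ n, (w n * Real.exp (m n) / Z) * (f n q - m n)) ∂P =
      Real.log Z := by
    rw [integral_add (integrable_const _) (integrable_finsetSum _ fun n _ => hint n),
      integral_finsetSum _ fun n _ => hint n]
    have : ∀ n, ∫ q, (w n * Real.exp (m n) / Z) * (f n q - m n) ∂P = 0 := fun n => by
      rw [integral_const_mul, integral_sub (hf n) (integrable_const _)]
      simp [hm]
    simp [this]
  have : Real.log Z ≤ ∫ q, g q ∂P := e ▸ hi
  calc Z = Real.exp (Real.log Z) := (Real.exp_log hpos).symm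
    _ ≤ _ := Real.exp_le_exp.2 this

/-! ### The positive part of a linear form on the sphere -/

theorem integral_max_mul_exp_neg_sq :
    ∫ t : ℝ, max t 0 * Real.exp (-t ^ 2) = 1 / 2 := by
  have h1 : ∫ t : ℝ, max t 0 * Real.exp (-t ^ 2) =
      ∫ t in Set.Ioi (0 : ℝ), max t 0 * Real.exp (-t ^ 2) := by
    refine (setIntegral_eq_integral_of_forall_compl_eq_zero fun t ht => ?_).symm
    rw [max_eq_right (not_lt.1 ht), zero_mul]
  have h2 := integral_rpow_mul_exp_neg_rpow (p := 2) (q := 1) (by norm_num) (by norm_num)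
  rw [h1, ← show (1 / 2 * Real.Gamma ((1 + 1) / 2) : ℝ) = 1 / 2 by norm_num, ← h2]
  refine setIntegral_congr_fun measurableSet_Ioi fun t (ht : 0 < t) => ?_
  simp [max_eq_left ht.le]

/-- The moment of order one of the positive part of the first coordinate, for the Gaussian
weight `exp (-‖y‖ ^ 2)`. -/
theorem integral_max_coord_mul_exp_neg_norm_sq (n : ℕ) :
    ∫ y : EuclideanSpace ℝ (Fin (n + 1)), max (y 0) 0 * Real.exp (-‖y‖ ^ 2) =
      1 / 2 * √Real.pi ^ n := by
  have h1 := (PiLp.volume_preserving_toLp (Fin (n + 1))).integral_comp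
    (MeasurableEquiv.toLp 2 (Fin (n + 1) → ℝ)).measurableEmbedding
    (fun y : EuclideanSpace ℝ (Fin (n + 1)) => max (y 0) 0 * Real.exp (-‖y‖ ^ 2))
  rw [← h1]
  have h2 := integral_fintype_prod_volume_eq_prod (𝕜 := ℝ) (E := fun _ : Fin (n + 1) => ℝ)
    (Fin.cons (fun t => max t 0 * Real.exp (-t ^ 2)) fun _ t => Real.exp (-t ^ 2))
  simp only [Fin.prod_univ_succ, Fin.cons_zero, Fin.cons_succ, integral_max_mul_exp_neg_sq] at h2
  have h3 : ∫ t : ℝ, Real.exp (-t ^ 2) = √Real.pi := by simpa using integral_gaussian 1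
  rw [h3, Finset.prod_const, Finset.card_univ, Fintype.card_fin] at h2
  rw [← h2]
  congr 1 with x
  rw [EuclideanSpace.norm_sq_eq, Fin.sum_univ_succ, neg_add, Real.exp_add, ← Finset.sum_neg_distrib,
    Real.exp_sum]
  simp [mul_assoc]

theorem integral_max_inner_mul_exp_neg_norm_sq {n : ℕ} {u : EuclideanSpace ℝ (Fin (n + 1))}
    (hu : ‖u‖ = 1) :
    ∫ y : EuclideanSpace ℝ (Fin (n + 1)), max (inner ℝ u y) 0 * Real.exp (-‖y‖ ^ 2) =
      1 / 2 * √Real.pi ^ n := by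
  -- a reflection that swaps `u` with the first vector of the standard basis
  set e : EuclideanSpace ℝ (Fin (n + 1)) := EuclideanSpace.single 0 1 with he
  set r := (Submodule.span ℝ {e - u})ᗮ.reflection with hr
  have hre : r e = u := Submodule.reflection_sub (by simp [he, hu])
  rw [← integral_max_coord_mul_exp_neg_norm_sq n,
    ← r.measurePreserving.integral_comp r.toHomeomorph.measurableEmbedding]
  congr 1 with y
  rw [← hre, r.inner_map_map, r.norm_map]
  simp [he, EuclideanSpace.inner_single_left]

/-- Polar coordinates for the product of a positively homogeneous function and a Gaussian. -/
theorem integral_max_inner_mul_exp_eq_toSphere {n : ℕ} (v : EuclideanSpace ℝ (Fin (n + 1))) :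
    ∫ y : EuclideanSpace ℝ (Fin (n + 1)), max (inner ℝ v y) 0 * Real.exp (-‖y‖ ^ 2) =
      (∫ θ : sphere (0 : EuclideanSpace ℝ (Fin (n + 1))) 1,
        max (inner ℝ v (θ : EuclideanSpace ℝ (Fin (n + 1)))) 0 ∂volume.toSphere) *
      (1 / 2 * Real.Gamma ((n : ℝ) / 2 + 1)) := by
  let μ : Measure (EuclideanSpace ℝ (Fin (n + 1))) := volume
  have hrad : ∫ r : Set.Ioi (0 : ℝ), (r : ℝ) * Real.exp (-(r : ℝ) ^ 2)
      ∂(Measure.volumeIoiPow (Module.finrank ℝ (EuclideanSpace ℝ (Fin (n + 1))) - 1)) =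
      1 / 2 * Real.Gamma ((n : ℝ) / 2 + 1) := by
    have h2 := integral_rpow_mul_exp_neg_rpow (p := 2) (q := n + 1) (by norm_num)
      (by have : (0 : ℝ) ≤ n := n.cast_nonneg
          linarith)
    rw [show ((n : ℝ) + 1 + 1) / 2 = (n : ℝ) / 2 + 1 by ring] at h2
    rw [← h2]
    simp only [Measure.volumeIoiPow, ENNReal.ofReal]
    rw [integral_withDensity_eq_integral_smul
        ((measurable_subtype_coe.pow_const _).real_toNNReal),
      integral_subtype_comap measurableSet_Ioi fun a : ℝ =>
        Real.toNNReal (a ^ (Module.finrank ℝ (EuclideanSpace ℝ (Fin (n + 1))) - 1)) •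
          (a * Real.exp (-a ^ 2))]
    refine setIntegral_congr_fun measurableSet_Ioi fun x (hx : 0 < x) => ?_
    simp only [NNReal.smul_def, Real.coe_toNNReal _ (pow_nonneg hx.le _), smul_eq_mul]
    rw [Real.rpow_add hx, Real.rpow_natCast, Real.rpow_one, Real.rpow_two]
    simp
    ring
  rw [← hrad, ← integral_prod_mul, ← μ.measurePreserving_homeomorphUnitSphereProd.integral_comp
    (Homeomorph.measurableEmbedding _)]
  have hpunct := integral_subtype_comap (μ := μ) (measurableSet_singleton 0).compl
    fun y => max (inner ℝ v y) 0 * Real.exp (-‖y‖ ^ 2)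
  rw [restrict_compl_singleton] at hpunct
  rw [← hpunct]
  congr 1 with y
  have hy : 0 < ‖(y : EuclideanSpace ℝ (Fin (n + 1)))‖ := norm_pos_iff.2 y.2
  rw [homeomorphUnitSphereProd_apply_snd_coe, homeomorphUnitSphereProd_apply_fst_coe,
    real_inner_smul_right, ← mul_assoc]
  congr 1
  rw [max_mul_of_nonneg _ _ hy.le]
  field_simp
  simp

/-- The positive part of `⟨v, θ⟩` has integral `κ ‖v‖` over the unit sphere of `ℝ^(n+1)`, where `κ`
is the volume of the unit ball of `ℝ^n` (the shadow of a hemisphere is a ball). The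
Gaussian integral of the positive part of a linear form is computed in Cartesian and
in polar coordinates. -/
theorem integral_max_inner_toSphere {n : ℕ} (hn : 0 < n) (v : EuclideanSpace ℝ (Fin (n + 1))) :
    ∫ θ : sphere (0 : EuclideanSpace ℝ (Fin (n + 1))) 1,
      max (inner ℝ v (θ : EuclideanSpace ℝ (Fin (n + 1)))) 0 ∂volume.toSphere =
    (volume : Measure (EuclideanSpace ℝ (Fin n))).real (ball 0 1) * ‖v‖ := by
  have : Nonempty (Fin n) := ⟨⟨0, hn⟩⟩
  have hΓ : 0 < Real.Gamma ((n : ℝ) / 2 + 1) := Real.Gamma_pos_of_pos (by positivity)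
  have hvol : (volume : Measure (EuclideanSpace ℝ (Fin n))).real (ball 0 1) =
      √Real.pi ^ n / Real.Gamma ((n : ℝ) / 2 + 1) := by
    rw [measureReal_def, EuclideanSpace.volume_ball, Fintype.card_fin]
    simp only [ENNReal.ofReal_one, one_pow, one_mul]
    exact ENNReal.toReal_ofReal (by positivity)
  rcases eq_or_ne v 0 with rfl | hv
  · simp
  have hv' : 0 < ‖v‖ := norm_pos_iff.2 hv
  have h := integral_max_inner_mul_exp_eq_toSphere (‖v‖⁻¹ • v)
  rw [integral_max_inner_mul_exp_neg_norm_sq (by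
    rw [norm_smul, norm_inv, norm_norm, inv_mul_cancel₀ hv'.ne'])] at h
  have e : ∀ y : EuclideanSpace ℝ (Fin (n + 1)),
      max (inner ℝ v y) 0 = ‖v‖ * max (inner ℝ (‖v‖⁻¹ • v) y) 0 := fun y => by
    rw [real_inner_smul_left, mul_max_of_nonneg _ _ hv'.le, mul_zero, mul_inv_cancel_left₀ hv'.ne']
  simp only [e, integral_const_mul]
  rw [hvol]
  field_simp at h ⊢
  linarith

/-! ### The energy distance and the sliced score -/

theorem volume_real_unitBall_pos (n : ℕ) :
    0 < (volume : Measure (EuclideanSpace ℝ (Fin n))).real (ball 0 1) :=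
  ENNReal.toReal_pos (measure_ball_pos _ _ one_pos).ne' measure_ball_lt_top.ne

theorem unitSphereArea_pos {n : ℕ} : 0 < unitSphereArea (n + 1) := by
  rw [unitSphereArea, Measure.toSphere_real_apply_univ]
  have := volume_real_unitBall_pos (n + 1)
  simp only [finrank_euclideanSpace_fin]
  positivity

theorem energyConst_eq {n : ℕ} (hn : 0 < n) : energyConst (n + 1) =
    unitSphereArea (n + 1) / (volume : Measure (EuclideanSpace ℝ (Fin n))).real (ball 0 1) := by
  have hB := volume_real_unitBall_pos n
  have hn' : (n : ℝ) ≠ 0 := by exact_mod_cast hn.ne'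
  rw [energyConst, Nat.add_sub_cancel, unitSphereArea, unitSphereArea,
    Measure.toSphere_real_apply_univ, Measure.toSphere_real_apply_univ]
  simp only [finrank_euclideanSpace_fin]
  push_cast
  field_simp
  ring

theorem energyConst_pos {n : ℕ} (hn : 0 < n) : 0 < energyConst (n + 1) := by
  rw [energyConst_eq hn]
  exact div_pos unitSphereArea_pos (volume_real_unitBall_pos n)

section scdf

variable {D : ℕ} {γ ω : Measure (EuclideanSpace ℝ (Fin D))}

theorem measurable_scdf [SFinite γ] :
    Measurable fun q : sphere (0 : EuclideanSpace ℝ (Fin D)) 1 × ℝ => scdf γ q.1 q.2 := by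
  have hT : MeasurableSet {z : (sphere (0 : EuclideanSpace ℝ (Fin D)) 1 × ℝ) ×
      EuclideanSpace ℝ (Fin D) | inner ℝ z.2 (z.1.1 : EuclideanSpace ℝ (Fin D)) ≤ z.1.2} :=
    measurableSet_le (by fun_prop) (by fun_prop)
  exact (measurable_measure_prodMk_left hT).ennreal_toReal

theorem scdf_mem_Icc [IsProbabilityMeasure γ] (θ : sphere (0 : EuclideanSpace ℝ (Fin D)) 1)
    (t : ℝ) : scdf γ θ t ∈ Set.Icc (0 : ℝ) 1 :=
  ⟨measureReal_nonneg, measureReal_le_one⟩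

theorem integrable_norm_sub_prod [IsProbabilityMeasure γ] [IsProbabilityMeasure ω]
    (hγ : Integrable (fun x => ‖x‖) γ) (hω : Integrable (fun x => ‖x‖) ω) :
    Integrable (fun p => ‖p.1 - p.2‖) (γ.prod ω) := by
  refine ((hγ.comp_fst ω).add (hω.comp_snd γ)).mono (by fun_prop) (.of_forall fun p => ?_)
  have : 0 ≤ ‖p.1‖ + ‖p.2‖ := by positivity
  simpa [abs_of_nonneg this] using norm_sub_le p.1 p.2

theorem abs_scdf_sub_sq (q : sphere (0 : EuclideanSpace ℝ (Fin D)) 1 × ℝ) :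
    |scdf γ q.1 q.2 - scdf ω q.1 q.2| ^ 2 =
      scdf γ q.1 q.2 * (1 - scdf ω q.1 q.2) + scdf ω q.1 q.2 * (1 - scdf γ q.1 q.2) -
      scdf γ q.1 q.2 * (1 - scdf γ q.1 q.2) - scdf ω q.1 q.2 * (1 - scdf ω q.1 q.2) := by
  rw [sq_abs]; ring

end scdf

section identity

variable {n : ℕ} {γ ω : Measure (EuclideanSpace ℝ (Fin (n + 1)))}
  [IsProbabilityMeasure γ] [IsProbabilityMeasure ω]

/-- Both sides are the measure of the set of all `((θ, t), (x, y))` with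
`⟨x, θ⟩ ≤ t < ⟨y, θ⟩`, computed by slicing in the two possible orders. -/
theorem lintegral_scdf_mul_one_sub_scdf (hn : 0 < n) :
    ∫⁻ q, ENNReal.ofReal (scdf γ q.1 q.2 * (1 - scdf ω q.1 q.2))
      ∂((volume : Measure (EuclideanSpace ℝ (Fin (n + 1)))).toSphere.prod volume) =
    ∫⁻ p, ENNReal.ofReal
      ((volume : Measure (EuclideanSpace ℝ (Fin n))).real (ball 0 1) * ‖p.1 - p.2‖)
      ∂(γ.prod ω) := by
  set σ := (volume : Measure (EuclideanSpace ℝ (Fin (n + 1)))).toSphere with hσ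
  set T : Set ((sphere (0 : EuclideanSpace ℝ (Fin (n + 1))) 1 × ℝ) ×
      (EuclideanSpace ℝ (Fin (n + 1)) × EuclideanSpace ℝ (Fin (n + 1)))) :=
    {z | inner ℝ z.2.1 (z.1.1 : EuclideanSpace ℝ (Fin (n + 1))) ≤ z.1.2 ∧
      z.1.2 < inner ℝ z.2.2 (z.1.1 : EuclideanSpace ℝ (Fin (n + 1)))} with hTdef
  have hT : MeasurableSet T := by
    rw [hTdef, Set.ofPred_and]
    exact (measurableSet_le (by fun_prop) (by fun_prop)).inter
      (measurableSet_lt (by fun_prop) (by fun_prop))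
  have h1 : ((σ.prod (volume : Measure ℝ)).prod (γ.prod ω)) T =
      ∫⁻ q, ENNReal.ofReal (scdf γ q.1 q.2 * (1 - scdf ω q.1 q.2)) ∂(σ.prod volume) := by
    rw [Measure.prod_apply hT]
    refine lintegral_congr fun q => ?_
    have hs : Prod.mk q ⁻¹' T =
        {x | inner ℝ x (q.1 : EuclideanSpace ℝ (Fin (n + 1))) ≤ q.2} ×ˢ
        {x | inner ℝ x (q.1 : EuclideanSpace ℝ (Fin (n + 1))) ≤ q.2}ᶜ := by
      ext p
      simp [hTdef]
    have hm : MeasurableSet {x | inner ℝ x (q.1 : EuclideanSpace ℝ (Fin (n + 1))) ≤ q.2} :=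
      measurableSet_le (by fun_prop) (by fun_prop)
    rw [hs, Measure.prod_prod, scdf, scdf, ENNReal.ofReal_mul measureReal_nonneg,
      ← probReal_compl_eq_one_sub hm, ofReal_measureReal, ofReal_measureReal]
  have h2 : ((σ.prod (volume : Measure ℝ)).prod (γ.prod ω)) T =
      ∫⁻ p, ENNReal.ofReal
      ((volume : Measure (EuclideanSpace ℝ (Fin n))).real (ball 0 1) * ‖p.1 - p.2‖)
      ∂(γ.prod ω) := by
    rw [Measure.prod_apply_symm hT]
    refine lintegral_congr fun p => ?_
    rw [norm_sub_rev, ← integral_max_inner_toSphere hn,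
      ofReal_integral_eq_lintegral_ofReal ?_ (.of_forall fun θ => ?_),
      Measure.prod_apply (hT.preimage (by fun_prop))]
    · refine lintegral_congr fun θ => ?_
      have hs : Prod.mk θ ⁻¹' ((fun x => (x, p)) ⁻¹' T) =
          Set.Ico (inner ℝ p.1 (θ : EuclideanSpace ℝ (Fin (n + 1))))
            (inner ℝ p.2 (θ : EuclideanSpace ℝ (Fin (n + 1)))) := by
        ext t
        simp [hTdef]
      rw [hs, Real.volume_Ico, inner_sub_left, ENNReal.ofReal_max]
      simp
    · exact (Continuous.integrable_of_hasCompactSupport (by fun_prop)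
        (HasCompactSupport.of_compactSpace _))
    · exact le_max_right _ _
  rw [← h1, h2]

theorem integrable_scdf_mul_one_sub_scdf (hγ : Integrable (fun x => ‖x‖) γ)
    (hω : Integrable (fun x => ‖x‖) ω) (hn : 0 < n) :
    Integrable (fun q : sphere (0 : EuclideanSpace ℝ (Fin (n + 1))) 1 × ℝ =>
      scdf γ q.1 q.2 * (1 - scdf ω q.1 q.2))
      ((volume : Measure (EuclideanSpace ℝ (Fin (n + 1)))).toSphere.prod volume) := by
  refine ⟨(measurable_scdf.mul (measurable_const.sub measurable_scdf)).aestronglyMeasurable, ?_⟩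
  rw [hasFiniteIntegral_iff_ofReal (.of_forall fun q => mul_nonneg (scdf_mem_Icc _ _).1
    (sub_nonneg.2 (scdf_mem_Icc _ _).2)), lintegral_scdf_mul_one_sub_scdf hn]
  exact ((integrable_norm_sub_prod hγ hω).const_mul _).lintegral_lt_top

theorem integral_scdf_mul_one_sub_scdf (hγ : Integrable (fun x => ‖x‖) γ)
    (hω : Integrable (fun x => ‖x‖) ω) (hn : 0 < n) :
    ∫ q, scdf γ q.1 q.2 * (1 - scdf ω q.1 q.2)
      ∂((volume : Measure (EuclideanSpace ℝ (Fin (n + 1)))).toSphere.prod volume) =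
    (volume : Measure (EuclideanSpace ℝ (Fin n))).real (ball 0 1) *
      ∫ p, ‖p.1 - p.2‖ ∂(γ.prod ω) := by
  rw [integral_eq_lintegral_of_nonneg_ae (.of_forall fun q => mul_nonneg (scdf_mem_Icc _ _).1
    (sub_nonneg.2 (scdf_mem_Icc _ _).2))
    (integrable_scdf_mul_one_sub_scdf hγ hω hn).aestronglyMeasurable,
    lintegral_scdf_mul_one_sub_scdf hn, ← integral_const_mul,
    integral_eq_lintegral_of_nonneg_ae (.of_forall fun p => by positivity) (by fun_prop)]

theorem integrable_abs_scdf_sub_sq (hγ : Integrable (fun x => ‖x‖) γ)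
    (hω : Integrable (fun x => ‖x‖) ω) (hn : 0 < n) :
    Integrable (fun q : sphere (0 : EuclideanSpace ℝ (Fin (n + 1))) 1 × ℝ =>
      |scdf γ q.1 q.2 - scdf ω q.1 q.2| ^ 2)
      ((volume : Measure (EuclideanSpace ℝ (Fin (n + 1)))).toSphere.prod volume) := by
  simp only [abs_scdf_sub_sq]
  exact (((integrable_scdf_mul_one_sub_scdf hγ hω hn).add
    (integrable_scdf_mul_one_sub_scdf hω hγ hn)).sub
    (integrable_scdf_mul_one_sub_scdf hγ hγ hn)).sub (integrable_scdf_mul_one_sub_scdf hω hω hn)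

theorem integral_abs_scdf_sub_sq (hγ : Integrable (fun x => ‖x‖) γ)
    (hω : Integrable (fun x => ‖x‖) ω) (hn : 0 < n) :
    ∫ q, |scdf γ q.1 q.2 - scdf ω q.1 q.2| ^ 2
      ∂((volume : Measure (EuclideanSpace ℝ (Fin (n + 1)))).toSphere.prod volume) =
    (volume : Measure (EuclideanSpace ℝ (Fin n))).real (ball 0 1) * energyDist γ ω := by
  have i1 := integrable_scdf_mul_one_sub_scdf hγ hω hn
  have i2 := integrable_scdf_mul_one_sub_scdf hω hγ hn
  have i3 := integrable_scdf_mul_one_sub_scdf hγ hγ hn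
  have i4 := integrable_scdf_mul_one_sub_scdf hω hω hn
  have hswap : ∫ p, ‖p.1 - p.2‖ ∂(ω.prod γ) = ∫ p, ‖p.1 - p.2‖ ∂(γ.prod ω) := by
    rw [← integral_prod_swap]
    simp only [Prod.fst_swap, Prod.snd_swap, norm_sub_rev]
  simp only [abs_scdf_sub_sq]
  rw [integral_sub (f := fun q => _ - _) ((i1.add i2).sub i3) i4,
    integral_sub (f := fun q => _ + _) (i1.add i2) i3, integral_add i1 i2,
    integral_scdf_mul_one_sub_scdf hγ hω hn, integral_scdf_mul_one_sub_scdf hω hγ hn,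
    integral_scdf_mul_one_sub_scdf hγ hγ hn, integral_scdf_mul_one_sub_scdf hω hω hn, hswap,
    energyDist]
  ring

theorem scrps_eq_integral_prod (hn : 0 < n) (hγ : Integrable (fun x => ‖x‖) γ)
    (hω : Integrable (fun x => ‖x‖) ω) : scrps γ ω = 1 / unitSphereArea (n + 1) *
    ∫ q, |scdf γ q.1 q.2 - scdf ω q.1 q.2| ^ 2
      ∂((volume : Measure (EuclideanSpace ℝ (Fin (n + 1)))).toSphere.prod volume) := by
  rw [scrps, integral_prod _ (integrable_abs_scdf_sub_sq hγ hω hn)]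

theorem energyDist_eq_energyConst_mul_scrps (hn : 0 < n) (hγ : Integrable (fun x => ‖x‖) γ)
    (hω : Integrable (fun x => ‖x‖) ω) : energyDist γ ω = energyConst (n + 1) * scrps γ ω := by
  have hB := volume_real_unitBall_pos n
  have hS := unitSphereArea_pos (n := n)
  rw [scrps_eq_integral_prod hn hγ hω, integral_abs_scdf_sub_sq hγ hω hn, energyConst_eq hn]
  field_simp

end identity

/-! ### Measures carried by a bounded set -/

section probOn

variable {D : ℕ} {R : ℝ} {X : Set (EuclideanSpace ℝ (Fin D))}
  {γ ω : Measure (EuclideanSpace ℝ (Fin D))}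

theorem sum_smul_mem_probOn {N : ℕ} {w : Fin N → ℝ≥0} (hw : ∑ n, w n = 1)
    {γ : Fin N → Measure (EuclideanSpace ℝ (Fin D))} (hγ : ∀ n, γ n ∈ probOn X) :
    ∑ n, w n • γ n ∈ probOn X := by
  refine ⟨⟨?_⟩, ?_⟩
  · have h1 : ∀ n, γ n Set.univ = 1 := fun n => (hγ n).1.measure_univ
    simp only [Measure.coe_finsetSum, Finset.sum_apply, Measure.smul_apply, h1,
      ENNReal.smul_def, smul_eq_mul, mul_one]
    exact_mod_cast hw
  · simp [fun n => (hγ n).2]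

theorem convex_probOn : Convex ℝ≥0 (probOn X) := by
  intro γ hγ ω hω a b _ _ hab
  have := sum_smul_mem_probOn (X := X) (w := ![a, b]) (γ := ![γ, ω]) (by simpa using hab)
    (by intro n; fin_cases n <;> simpa)
  simpa using this

theorem scdf_sum_smul {N : ℕ} (w : Fin N → ℝ≥0) (γ : Fin N → Measure (EuclideanSpace ℝ (Fin D)))
    [∀ n, IsFiniteMeasure (γ n)] (θ : sphere (0 : EuclideanSpace ℝ (Fin D)) 1) (t : ℝ) :
    scdf (∑ n, w n • γ n) θ t = ∑ n, (w n : ℝ) * scdf (γ n) θ t := by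
  simp only [scdf, measureReal_def, Measure.coe_finsetSum, Finset.sum_apply, Measure.smul_apply,
    ENNReal.smul_def, smul_eq_mul]
  rw [ENNReal.toReal_sum fun n _ => ENNReal.mul_ne_top (by simp) (measure_ne_top _ _)]
  simp

theorem ae_norm_le_of_mem_probOn (hX : X ⊆ closedBall 0 R) (hγ : γ ∈ probOn X) :
    ∀ᵐ x ∂γ, ‖x‖ ≤ R := by
  have h : ∀ᵐ x ∂γ, x ∈ X := by rw [ae_iff]; exact hγ.2
  filter_upwards [h] with x hx
  simpa using hX hx

theorem integrable_norm_of_mem_probOn (hX : X ⊆ closedBall 0 R) (hγ : γ ∈ probOn X) :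
    Integrable (fun x => ‖x‖) γ := by
  have := hγ.1
  refine Integrable.of_bound (by fun_prop) R ?_
  simpa using ae_norm_le_of_mem_probOn hX hγ

theorem scdf_eq_of_notMem_Icc (hX : X ⊆ closedBall 0 R) (hγ : γ ∈ probOn X) (hω : ω ∈ probOn X)
    (θ : sphere (0 : EuclideanSpace ℝ (Fin D)) 1) {t : ℝ} (ht : t ∉ Set.Icc (-R) R) :
    scdf γ θ t = scdf ω θ t := by
  have hθ : ‖(θ : EuclideanSpace ℝ (Fin D))‖ = 1 := by simp
  have key : ∀ x : EuclideanSpace ℝ (Fin D), ‖x‖ ≤ R →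
      |inner ℝ x (θ : EuclideanSpace ℝ (Fin D))| ≤ R := fun x hx => by
    have := abs_real_inner_le_norm x (θ : EuclideanSpace ℝ (Fin D))
    rw [hθ, mul_one] at this
    exact this.trans hx
  rcases lt_or_ge t (-R) with h | h
  · have h0 : ∀ υ ∈ probOn X, scdf υ θ t = 0 := fun υ hυ => by
      rw [scdf, measureReal_def, measure_eq_zero_iff_ae_notMem.2, ENNReal.toReal_zero]
      filter_upwards [ae_norm_le_of_mem_probOn hX hυ] with x hx
      have := (abs_le.1 (key x hx)).1
      exact not_le.2 (h.trans_le this)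
    rw [h0 γ hγ, h0 ω hω]
  · have h1 : ∀ υ ∈ probOn X, scdf υ θ t = 1 := fun υ hυ => by
      have := hυ.1
      have hm : MeasurableSet {x | inner ℝ x (θ : EuclideanSpace ℝ (Fin D)) ≤ t} :=
        measurableSet_le (by fun_prop) (by fun_prop)
      rw [scdf, measureReal_def, (mem_ae_iff_prob_eq_one hm).1, ENNReal.toReal_one]
      filter_upwards [ae_norm_le_of_mem_probOn hX hυ] with x hx
      have := (abs_le.1 (key x hx)).2
      have : R < t := by
        by_contra! h'
        exact ht ⟨h, h'⟩
      exact (‹inner ℝ x (θ : EuclideanSpace ℝ (Fin D)) ≤ R›.trans this.le)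
    rw [h1 γ hγ, h1 ω hω]

end probOn

/-- The uniform distribution on the product of the unit sphere of `ℝ^D` and the interval
`[-R, R]`, that is, on the pairs of a direction and a threshold that matter for measures carried
by the ball of radius `R`. -/
noncomputable def slicedUniform (D : ℕ) (R : ℝ) :
    Measure (sphere (0 : EuclideanSpace ℝ (Fin D)) 1 × ℝ) :=
  ProbabilityTheory.cond ((volume : Measure (EuclideanSpace ℝ (Fin D))).toSphere.prod volume)
    (Set.univ ×ˢ Set.Icc (-R) R)

section slicedUniform

variable {n : ℕ} {R : ℝ} {X : Set (EuclideanSpace ℝ (Fin (n + 1)))}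
  {γ ω : Measure (EuclideanSpace ℝ (Fin (n + 1)))}

theorem isProbabilityMeasure_slicedUniform (hR : 0 < R) :
    IsProbabilityMeasure (slicedUniform (n + 1) R) := by
  refine ProbabilityTheory.cond_isProbabilityMeasure_of_finite ?_ ?_
  · rw [Measure.prod_prod, Real.volume_Icc]
    exact mul_ne_zero (by rw [Ne, Measure.measure_univ_eq_zero]; exact Measure.toSphere_ne_zero _)
      (by simp; linarith)
  · rw [Measure.prod_prod, Real.volume_Icc]
    exact ENNReal.mul_ne_top (measure_ne_top _ _) (by simp)

theorem scrps_eq_integral_slicedUniform (hn : 0 < n) (hR : 0 < R) (hX : X ⊆ closedBall 0 R)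
    (hγ : γ ∈ probOn X) (hω : ω ∈ probOn X) :
    scrps γ ω = 2 * R * ∫ q, (scdf γ q.1 q.2 - scdf ω q.1 q.2) ^ 2 ∂slicedUniform (n + 1) R := by
  have := hγ.1
  have := hω.1
  have hS := unitSphereArea_pos (n := n)
  rw [scrps_eq_integral_prod hn (integrable_norm_of_mem_probOn hX hγ)
    (integrable_norm_of_mem_probOn hX hω), slicedUniform, ProbabilityTheory.cond,
    integral_smul_measure, setIntegral_eq_integral_of_forall_compl_eq_zero]
  · rw [Measure.prod_prod, Real.volume_Icc, ENNReal.toReal_inv, ENNReal.toReal_mul,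
      ENNReal.toReal_ofReal (by linarith), ← measureReal_def, ← unitSphereArea]
    simp only [sq_abs, smul_eq_mul]
    field_simp
    ring
  · intro q hq
    rw [scdf_eq_of_notMem_Icc hX hγ hω _ fun h => hq ⟨Set.mem_univ _, h⟩]
    simp

theorem memLp_slicedUniform_of_mem_Icc (hR : 0 < R)
    {f : sphere (0 : EuclideanSpace ℝ (Fin (n + 1))) 1 × ℝ → ℝ} (hf : Measurable f)
    (h01 : ∀ q, f q ∈ Set.Icc (0 : ℝ) 1) : MemLp f 2 (slicedUniform (n + 1) R) := by
  have := isProbabilityMeasure_slicedUniform (n := n) hR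
  refine MemLp.of_bound hf.aestronglyMeasurable 1 (.of_forall fun q => ?_)
  rw [Real.norm_of_nonneg (h01 q).1]
  exact (h01 q).2

end slicedUniform

/-! ### Projection onto the sliced distribution functions -/

/-- Projecting onto a compact convex set does not increase the distance to any point of
the set. -/
theorem exists_forall_norm_sub_le_of_convex {F : Type*} [NormedAddCommGroup F]
    [InnerProductSpace ℝ F] {K : Set F} (hne : K.Nonempty) (hc : IsCompact K) (hK : Convex ℝ K)
    (u : F) : ∃ v ∈ K, ∀ w ∈ K, ‖v - w‖ ≤ ‖u - w‖ := by
  obtain ⟨v, hv, h⟩ := exists_norm_eq_iInf_of_complete_convex hne hc.isComplete hK u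
  refine ⟨v, hv, fun w hw => ?_⟩
  have hi := (norm_eq_iInf_iff_real_inner_le_zero hK hv).1 h w hw
  have e : ‖u - w‖ ^ 2 = ‖u - v‖ ^ 2 - 2 * inner ℝ (u - v) (w - v) + ‖w - v‖ ^ 2 := by
    rw [← norm_sub_sq_real, sub_sub_sub_cancel_right]
  rw [norm_sub_rev w v] at e
  refine abs_le_of_sq_le_sq' ?_ (norm_nonneg _) |>.2
  nlinarith [sq_nonneg ‖u - v‖]

theorem norm_toLp_sub_toLp_sq {Ω : Type*} [MeasurableSpace Ω] {P : Measure Ω} {f g : Ω → ℝ}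
    (hf : MemLp f 2 P) (hg : MemLp g 2 P) :
    ‖hf.toLp - hg.toLp‖ ^ 2 = ∫ q, (f q - g q) ^ 2 ∂P := by
  rw [← MemLp.toLp_sub, ← real_inner_self_eq_norm_sq, L2.inner_def]
  refine integral_congr_ae ?_
  filter_upwards [(hf.sub hg).coeFn_toLp] with q hq
  rw [hq]
  simp [sq]

section projection

variable {n : ℕ} {R : ℝ} {X : Set (EuclideanSpace ℝ (Fin (n + 1)))}

theorem memLp_scdf (hR : 0 < R) (γ : ProbabilityMeasure (EuclideanSpace ℝ (Fin (n + 1)))) :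
    MemLp (fun q => scdf (γ : Measure (EuclideanSpace ℝ (Fin (n + 1)))) q.1 q.2) 2
      (slicedUniform (n + 1) R) :=
  memLp_slicedUniform_of_mem_Icc hR measurable_scdf fun q => scdf_mem_Icc q.1 q.2

/-- Continuity for the weak topology of the mean distance. The distance is truncated at `2 * R`,
which does not matter for measures carried by the ball of radius `R`. -/
theorem continuous_integral_min_norm_sub (R : ℝ) :
    Continuous fun m : ProbabilityMeasure (EuclideanSpace ℝ (Fin (n + 1))) ×
      ProbabilityMeasure (EuclideanSpace ℝ (Fin (n + 1))) =>
        ∫ p, min ‖p.1 - p.2‖ (2 * R) ∂(m.1.toMeasure.prod m.2.toMeasure) := by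
  let τ : BoundedContinuousFunction
      (EuclideanSpace ℝ (Fin (n + 1)) × EuclideanSpace ℝ (Fin (n + 1))) ℝ :=
    BoundedContinuousFunction.ofNormedAddCommGroup (fun p => min ‖p.1 - p.2‖ (2 * R))
      (by fun_prop) (|2 * R|) (fun p => by
        rw [Real.norm_eq_abs, abs_le]
        refine ⟨le_min ?_ (neg_abs_le _), (min_le_right _ _).trans (le_abs_self _)⟩
        exact (neg_nonpos.2 (abs_nonneg _)).trans (norm_nonneg _))
  exact (ProbabilityMeasure.continuous_integral_boundedContinuousFunction τ).comp
    ProbabilityMeasure.continuous_prod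

theorem integral_min_norm_sub {γ ω : Measure (EuclideanSpace ℝ (Fin (n + 1)))}
    (hX : X ⊆ closedBall 0 R) (hγ : γ ∈ probOn X) (hω : ω ∈ probOn X) :
    ∫ p, min ‖p.1 - p.2‖ (2 * R) ∂(γ.prod ω) = ∫ p, ‖p.1 - p.2‖ ∂(γ.prod ω) := by
  have := hγ.1
  have := hω.1
  refine integral_congr_ae ?_
  have h1 := Measure.quasiMeasurePreserving_fst (μ := γ) (ν := ω) |>.ae
    (ae_norm_le_of_mem_probOn hX hγ)
  have h2 := Measure.quasiMeasurePreserving_snd (μ := γ) (ν := ω) |>.ae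
    (ae_norm_le_of_mem_probOn hX hω)
  filter_upwards [h1, h2] with p hp1 hp2
  exact min_eq_left ((norm_sub_le _ _).trans (by linarith))

/-- Weak convergence of measures carried by `X` implies convergence in `L²` of their sliced
distribution functions, since the distance in `L²` is a multiple of the energy distance. -/
theorem continuousOn_toLp_scdf (hn : 0 < n) (hR : 0 < R) (hX : X ⊆ closedBall 0 R) :
    ContinuousOn (fun γ : ProbabilityMeasure (EuclideanSpace ℝ (Fin (n + 1))) =>
      (memLp_scdf hR γ).toLp) {γ | (γ : Measure (EuclideanSpace ℝ (Fin (n + 1)))) ∈ probOn X} := by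
  intro γ₀ hγ₀
  rw [ContinuousWithinAt, tendsto_iff_norm_sub_tendsto_zero]
  have hC := energyConst_pos hn
  obtain ⟨I, hI⟩ : ∃ I : ProbabilityMeasure (EuclideanSpace ℝ (Fin (n + 1))) ×
      ProbabilityMeasure (EuclideanSpace ℝ (Fin (n + 1))) → ℝ,
      I = fun m => ∫ p, min ‖p.1 - p.2‖ (2 * R) ∂(m.1.toMeasure.prod m.2.toMeasure) := ⟨_, rfl⟩
  have hIc : Continuous I := hI ▸ continuous_integral_min_norm_sub R
  have hlim : Filter.Tendsto
      (fun γ => √((2 * I (γ, γ₀) - I (γ, γ) - I (γ₀, γ₀)) / (energyConst (n + 1) * (2 * R))))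
      (nhdsWithin γ₀ {γ | (γ : Measure (EuclideanSpace ℝ (Fin (n + 1)))) ∈ probOn X})
      (nhds 0) := by
    have hcont : Continuous fun γ =>
        √((2 * I (γ, γ₀) - I (γ, γ) - I (γ₀, γ₀)) / (energyConst (n + 1) * (2 * R))) := by
      fun_prop
    have h0 : √((2 * I (γ₀, γ₀) - I (γ₀, γ₀) - I (γ₀, γ₀)) / (energyConst (n + 1) * (2 * R))) =
        0 := by
      rw [sub_sub, ← two_mul, sub_self, zero_div, Real.sqrt_zero]
    have := hcont.tendsto γ₀
    rw [h0] at this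
    exact tendsto_nhdsWithin_of_tendsto_nhds this
  refine hlim.congr' ?_
  filter_upwards [self_mem_nhdsWithin] with γ hγ
  simp only [hI]
  rw [integral_min_norm_sub hX hγ hγ₀, integral_min_norm_sub hX hγ hγ,
    integral_min_norm_sub hX hγ₀ hγ₀, ← energyDist,
    energyDist_eq_energyConst_mul_scrps hn (integrable_norm_of_mem_probOn hX hγ)
      (integrable_norm_of_mem_probOn hX hγ₀),
    scrps_eq_integral_slicedUniform hn hR hX hγ hγ₀, ← norm_toLp_sub_toLp_sq (memLp_scdf hR γ)
      (memLp_scdf hR γ₀)]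
  rw [← mul_assoc, mul_div_cancel_left₀ _ (by positivity), Real.sqrt_sq (norm_nonneg _)]

theorem isCompact_probOn (hX : IsCompact X) :
    IsCompact {γ : ProbabilityMeasure (EuclideanSpace ℝ (Fin (n + 1))) |
      (γ : Measure (EuclideanSpace ℝ (Fin (n + 1)))) ∈ probOn X} := by
  have h := isCompact_setOfPred_probabilityMeasure_mass_eq_compl_isCompact_le
    (E := EuclideanSpace ℝ (Fin (n + 1))) (u := fun _ => 0) (K := fun _ => X)
    tendsto_const_nhds (fun _ => hX) (.inl inferInstance)
  convert h using 3 with γ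
  simp only [probOn, Set.mem_ofPred_eq, forall_const, nonpos_iff_eq_zero,
    ProbabilityMeasure.null_iff_toMeasure_null]
  exact ⟨fun h => h.2, fun h => ⟨γ.2, h⟩⟩

/-- A square integrable function of direction and threshold need not be a sliced distribution
function, but some measure carried by `X` is at least as close as it to the sliced distribution
functions of all measures carried by `X`. -/
theorem exists_mem_probOn_forall_integral_le (hn : 0 < n) (hR : 0 < R) (hXc : IsCompact X)
    (hX : X ⊆ closedBall 0 R) (hne : (probOn X).Nonempty)
    {f : sphere (0 : EuclideanSpace ℝ (Fin (n + 1))) 1 × ℝ → ℝ}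
    (hf : MemLp f 2 (slicedUniform (n + 1) R)) :
    ∃ γbar ∈ probOn X, ∀ ω ∈ probOn X,
      ∫ q, (scdf γbar q.1 q.2 - scdf ω q.1 q.2) ^ 2 ∂slicedUniform (n + 1) R ≤
        ∫ q, (f q - scdf ω q.1 q.2) ^ 2 ∂slicedUniform (n + 1) R := by
  set S : Set (ProbabilityMeasure (EuclideanSpace ℝ (Fin (n + 1)))) :=
    {γ | (γ : Measure (EuclideanSpace ℝ (Fin (n + 1)))) ∈ probOn X}
  set Φ := fun γ : ProbabilityMeasure (EuclideanSpace ℝ (Fin (n + 1))) =>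
    (memLp_scdf hR γ).toLp
  have hconv : Convex ℝ (Φ '' S) := by
    rintro _ ⟨γ, hγ, rfl⟩ _ ⟨ω, hω, rfl⟩ a b ha hb hab
    lift a to ℝ≥0 using ha
    lift b to ℝ≥0 using hb
    have hmem := sum_smul_mem_probOn (X := X) (w := ![a, b])
      (γ := ![(γ : Measure (EuclideanSpace ℝ (Fin (n + 1)))), ω])
      (by simpa using by exact_mod_cast hab) (by intro n; fin_cases n <;> simpa)
    refine ⟨⟨_, hmem.1⟩, hmem, ?_⟩
    simp only [Φ]
    rw [← MemLp.toLp_const_smul, ← MemLp.toLp_const_smul, ← MemLp.toLp_add]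
    congr 1
    ext q
    have : ∀ k, IsFiniteMeasure
        (![(γ : Measure (EuclideanSpace ℝ (Fin (n + 1)))), (ω : Measure _)] k) := by
      intro k; fin_cases k <;> simp <;> infer_instance
    have := scdf_sum_smul ![a, b] ![(γ : Measure (EuclideanSpace ℝ (Fin (n + 1)))),
      (ω : Measure _)] q.1 q.2
    simpa using this
  obtain ⟨γ₀, hγ₀⟩ := hne
  obtain ⟨_, ⟨γ, hγ, rfl⟩, h⟩ := exists_forall_norm_sub_le_of_convex
    (K := Φ '' S) ⟨_, ⟨γ₀, hγ₀.1⟩, hγ₀, rfl⟩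
    ((isCompact_probOn hXc).image_of_continuousOn (continuousOn_toLp_scdf hn hR hX)) hconv
    hf.toLp
  refine ⟨γ, hγ, fun ω hω => ?_⟩
  have hle := pow_le_pow_left₀ (norm_nonneg _) (h _ ⟨⟨ω, hω.1⟩, hω, rfl⟩) 2
  rwa [norm_toLp_sub_toLp_sq, norm_toLp_sub_toLp_sq] at hle

end projection

/-! ### Rates of mixability and exponential concavity -/

section rates

theorem isMixable_div_iff {A B : Type*} {Γ : Set A} {Ω : Set B} {loss loss' : A → B → ℝ}
    {c : ℝ} (hc : c ≠ 0) (h : ∀ γ ∈ Γ, ∀ ω ∈ Ω, loss γ ω = c * loss' γ ω) (η : ℝ) :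
    IsMixable Γ Ω loss (η / c) ↔ IsMixable Γ Ω loss' η := by
  have e : ∀ γ ∈ Γ, ∀ ω ∈ Ω, -(η / c) * loss γ ω = -η * loss' γ ω := fun γ hγ ω hω => by
    rw [h γ hγ ω hω]
    field_simp
  refine forall₅_congr fun N w hw γ hγ => exists_congr fun γbar => and_congr_right fun hb =>
    forall₂_congr fun ω hω => ?_
  rw [e γbar hb ω hω, Finset.sum_congr rfl fun n _ => by rw [e (γ n) (hγ n) ω hω]]

variable {n : ℕ} {R η : ℝ} {X : Set (EuclideanSpace ℝ (Fin (n + 1)))}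

theorem isExpConcave_div_iff {D : ℕ} {X : Set (EuclideanSpace ℝ (Fin D))}
    {loss loss' : Measure (EuclideanSpace ℝ (Fin D)) → Measure (EuclideanSpace ℝ (Fin D)) → ℝ}
    {c : ℝ} (hc : c ≠ 0) (h : ∀ γ ∈ probOn X, ∀ ω ∈ probOn X, loss γ ω = c * loss' γ ω) (η : ℝ) :
    IsExpConcave (probOn X) (probOn X) loss (η / c) ↔
      IsExpConcave (probOn X) (probOn X) loss' η := by
  have e : ∀ γ ∈ probOn X, ∀ ω ∈ probOn X, -(η / c) * loss γ ω = -η * loss' γ ω :=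
    fun γ hγ ω hω => by
      rw [h γ hγ ω hω]
      field_simp
  refine and_congr_right fun _ => forall₅_congr fun N w hw γ hγ => forall₂_congr fun ω hω => ?_
  rw [e _ (sum_smul_mem_probOn hw hγ) ω hω,
    Finset.sum_congr rfl fun n _ => by rw [e (γ n) (hγ n) ω hω]]

/-- A bound between exponentials of square losses at each direction and threshold integrates to
a bound between exponentials of sliced scores. -/
theorem sum_exp_scrps_le (hn : 0 < n) (hR : 0 < R) (hX : X ⊆ closedBall 0 R)
    {N : ℕ} {w : Fin N → ℝ≥0} {γ : Fin N → Measure (EuclideanSpace ℝ (Fin (n + 1)))}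
    (hγ : ∀ k, γ k ∈ probOn X) {ω : Measure (EuclideanSpace ℝ (Fin (n + 1)))}
    (hω : ω ∈ probOn X) {f : sphere (0 : EuclideanSpace ℝ (Fin (n + 1))) 1 × ℝ → ℝ}
    (hf : MemLp f 2 (slicedUniform (n + 1) R))
    (h : ∀ q, ∑ k, (w k : ℝ) *
        Real.exp (-(2 * R * η) * (scdf (γ k) q.1 q.2 - scdf ω q.1 q.2) ^ 2) ≤
      Real.exp (-(2 * R * η) * (f q - scdf ω q.1 q.2) ^ 2)) :
    ∑ k, (w k : ℝ) * Real.exp (-η * scrps (γ k) ω) ≤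
      Real.exp (-(2 * R * η) *
        ∫ q, (f q - scdf ω q.1 q.2) ^ 2 ∂slicedUniform (n + 1) R) := by
  have := isProbabilityMeasure_slicedUniform (n := n) hR
  have hi : ∀ {g}, MemLp g 2 (slicedUniform (n + 1) R) →
      Integrable (fun q => (g q - scdf ω q.1 q.2) ^ 2) (slicedUniform (n + 1) R) :=
    fun hg => (hg.sub (memLp_scdf hR ⟨ω, hω.1⟩)).integrable_sq
  have key := sum_exp_integral_le (P := slicedUniform (n + 1) R) w
    (fun k => (hi (memLp_scdf hR ⟨γ k, (hγ k).1⟩)).const_mul (-(2 * R * η)))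
    ((hi hf).const_mul (-(2 * R * η))) h
  simp only [integral_const_mul] at key
  refine le_trans (le_of_eq (Finset.sum_congr rfl fun k _ => ?_)) key
  rw [scrps_eq_integral_slicedUniform hn hR hX (hγ k) hω]
  simp only [ProbabilityMeasure.coe_mk]
  congr 2
  ring

theorem isExpConcave_scrps (hn : 0 < n) (hR : 0 < R) (hX : X ⊆ closedBall 0 R) (hη : 0 < η)
    (hηR : η ≤ 1 / (4 * R)) : IsExpConcave (probOn X) (probOn X) scrps η := by
  refine ⟨convex_probOn, fun N w hw γ hγ ω hω => ?_⟩
  rw [le_div_iff₀ (by positivity)] at hηR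
  have hmem := sum_smul_mem_probOn hw hγ
  have := hω.1
  have := fun k => (hγ k).1
  refine (sum_exp_scrps_le hn hR hX hγ hω (memLp_scdf hR ⟨_, hmem.1⟩) fun q => ?_).trans_eq ?_
  · simp only [ProbabilityMeasure.coe_mk]
    rw [scdf_sum_smul]
    exact sum_exp_le_exp_sum (by positivity) (by linarith) hw (fun k => scdf_mem_Icc _ _)
      (scdf_mem_Icc _ _)
  · rw [scrps_eq_integral_slicedUniform hn hR hX hmem hω]
    simp only [ProbabilityMeasure.coe_mk]
    congr 1
    ring

theorem isMixable_scrps (hn : 0 < n) (hR : 0 < R) (hXc : IsCompact X) (hX : X ⊆ closedBall 0 R)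
    (hη : 0 < η) (hηR : η ≤ 1 / R) : IsMixable (probOn X) (probOn X) scrps η := by
  intro N w hw γ hγ
  rw [le_div_iff₀ hR] at hηR
  have := fun k => (hγ k).1
  have hne : (probOn X).Nonempty := ⟨_, sum_smul_mem_probOn hw hγ⟩
  have ha : 0 < 2 * R * η := by positivity
  -- the pointwise aggregate, to be replaced by the sliced distribution function of a measure on `X`
  have hf : MemLp (fun q => squareLossAggregate (2 * R * η) w fun k => scdf (γ k) q.1 q.2) 2
      (slicedUniform (n + 1) R) := by
    refine memLp_slicedUniform_of_mem_Icc hR ?_ fun q =>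
      squareLossAggregate_mem_Icc ha hw fun k => scdf_mem_Icc _ _
    have hm := fun k => measurable_scdf (γ := γ k)
    unfold squareLossAggregate
    fun_prop
  obtain ⟨γbar, hbar, h⟩ := exists_mem_probOn_forall_integral_le hn hR hXc hX hne hf
  refine ⟨γbar, hbar, fun ω hω => ?_⟩
  have := hω.1
  refine (sum_exp_scrps_le hn hR hX hγ hω hf fun q =>
    sum_exp_le_exp_squareLossAggregate ha (by linarith) hw (fun k => scdf_mem_Icc _ _)
      (scdf_mem_Icc _ _)).trans ?_
  rw [scrps_eq_integral_slicedUniform hn hR hX hbar hω, Real.exp_le_exp]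
  have := mul_le_mul_of_nonneg_left (h ω hω) ha.le
  linarith

end rates

theorem theorem2 (D : ℕ) (hD : 1 < D) :
    -- the identity, with all the integrals in it absolutely convergent
    (∀ γ ω : Measure (EuclideanSpace ℝ (Fin D)),
      IsProbabilityMeasure γ → IsProbabilityMeasure ω →
      Integrable (fun x => ‖x‖) γ → Integrable (fun x => ‖x‖) ω →
        (Integrable (fun p => ‖p.1 - p.2‖) (γ.prod ω) ∧
          Integrable (fun p => ‖p.1 - p.2‖) (γ.prod γ) ∧
          Integrable (fun p => ‖p.1 - p.2‖) (ω.prod ω)) ∧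
        Integrable
          (fun q : sphere (0 : EuclideanSpace ℝ (Fin D)) 1 × ℝ =>
            |scdf γ q.1 q.2 - scdf ω q.1 q.2| ^ 2)
          ((volume : Measure (EuclideanSpace ℝ (Fin D))).toSphere.prod volume) ∧
        energyDist γ ω = energyConst D * scrps γ ω) ∧
    -- mixability and exponential concavity on bounded domains
    (∀ (R : ℝ), 0 < R → ∀ X : Set (EuclideanSpace ℝ (Fin D)),
      IsCompact X → X ⊆ closedBall 0 R →
        -- the rates of the energy distance are those of SCRPS divided by the constant
        (∀ η : ℝ, 0 < η →
          (IsMixable (probOn X) (probOn X) energyDist (η / energyConst D) ↔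
            IsMixable (probOn X) (probOn X) scrps η) ∧
          (IsExpConcave (probOn X) (probOn X) energyDist (η / energyConst D) ↔
            IsExpConcave (probOn X) (probOn X) scrps η)) ∧
        -- rates of SCRPS
        (∀ η : ℝ, 0 < η → η ≤ 1 / R → IsMixable (probOn X) (probOn X) scrps η) ∧
        (∀ η : ℝ, 0 < η → η ≤ 1 / (4 * R) → IsExpConcave (probOn X) (probOn X) scrps η) ∧
        -- rates of the energy distance
        (∀ η : ℝ, 0 < η → η ≤ 1 / R / energyConst D →
          IsMixable (probOn X) (probOn X) energyDist η) ∧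
        (∀ η : ℝ, 0 < η → η ≤ 1 / (4 * R) / energyConst D →
          IsExpConcave (probOn X) (probOn X) energyDist η)) := by
  obtain ⟨n, rfl⟩ : ∃ n, D = n + 1 := ⟨D - 1, by omega⟩
  have hn : 0 < n := by omega
  have hC := energyConst_pos hn
  refine ⟨fun γ ω _ _ hγ hω => ⟨⟨integrable_norm_sub_prod hγ hω, integrable_norm_sub_prod hγ hγ,
    integrable_norm_sub_prod hω hω⟩, integrable_abs_scdf_sub_sq hγ hω hn,
    energyDist_eq_energyConst_mul_scrps hn hγ hω⟩, fun R hR X hXc hX => ?_⟩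
  have heq : ∀ γ ∈ probOn X, ∀ ω ∈ probOn X,
      energyDist γ ω = energyConst (n + 1) * scrps γ ω := fun γ hγ ω hω => by
    have := hγ.1
    have := hω.1
    exact energyDist_eq_energyConst_mul_scrps hn (integrable_norm_of_mem_probOn hX hγ)
      (integrable_norm_of_mem_probOn hX hω)
  have hmix : ∀ η : ℝ, 0 < η → η ≤ 1 / R → IsMixable (probOn X) (probOn X) scrps η :=
    fun η hη hηR => isMixable_scrps hn hR hXc hX hη hηR
  have hexp : ∀ η : ℝ, 0 < η → η ≤ 1 / (4 * R) → IsExpConcave (probOn X) (probOn X) scrps η :=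
    fun η hη hηR => isExpConcave_scrps hn hR hX hη hηR
  refine ⟨fun η _ => ⟨isMixable_div_iff hC.ne' heq η, isExpConcave_div_iff hC.ne' heq η⟩,
    hmix, hexp, fun η hη hηR => ?_, fun η hη hηR => ?_⟩
  · have := (isMixable_div_iff hC.ne' heq (η * energyConst (n + 1))).2
      (hmix _ (by positivity) ((le_div_iff₀ hC).1 hηR))
    rwa [mul_div_cancel_right₀ _ hC.ne'] at this
  · have := (isExpConcave_div_iff hC.ne' heq (η * energyConst (n + 1))).2
      (hexp _ (by positivity) ((le_div_iff₀ hC).1 hηR))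
    rwa [mul_div_cancel_right₀ _ hC.ne'] at this
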